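/- Let $d\in\mathbb N$, let $\mathcal M_d$ be the set of complex $d\times d$ matrices, let $1\le k\le d$ be an integer and $p>0$ a real number. For a Hermitian matrix $A\in\mathcal M_d$ let $\lambda_1^\uparrow(A)\le\dots\le\lambda_d^\uparrow(A)$ be its eigenvalues, and for $T\in\mathcal M_d$ let $s_1^\uparrow(T)\le\dots\le s_d^\uparrow(T)$ be its singular values, in both cases with multiplicity and in increasing order. Let $\mathcal G\subset\mathcal M_d$ be compact and convex with $0\in\mathcal G$. Let $\mathcal I_{\mathcal G}$ be the set of all $T\in\mathcal M_d$ such that for every $\varepsilon>0$ there are $n\in\mathbb N$ and $G_1,\dots,G_n\in\mathcal G$ with $\|e^{G_j}-\mathbb 1_d\|\le\varepsilon$ for all $j$ and $\prod_{j=1}^n e^{G_j}=T$; the elements of its closure $\overline{\mathcal I}_{\mathcal G}$ are called infinitesimal Markovian divisible with respect to $\mathcal G$. Assume that every matrix $\tilde G$ of the form $\tilde G=\lambda G$, with $\lambda\in[0,1]$ and $G$ an extreme point of $\mathcal G$, satisfies $$\operatorname{Tr}[\tilde G+\tilde G^*]-p\sum_{i=1}^k\lambda_i^\uparrow(\tilde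 G+\tilde G^*)\le 0 .$$ Then every $T\in\overline{\mathcal I}_{\mathcal G}$ satisfies $$|\det T|\le\Big(\prod_{i=1}^k s_i^\uparrow(T)\Big)^p .$$ If moreover $\det(e^{G})$ is real for every $G\in\mathcal G$ (equivalently, $\operatorname{Tr}G\in\mathbb R$ for every $G\in\mathcal G$; for instance, if $\mathcal G$ consists of real matrices), then every $T\in\overline{\mathcal I}_{\mathcal G}$ satisfies $$0\le\det T\le\Big(\prod_{i=1}^k s_i^\uparrow(T)\Big)^p .$$ -/

import Mathlib

open scoped Matrix ComplexOrder

noncomputable section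

namespace MarkovDiv

variable {d : ℕ}

/-- The eigenvalues of a Hermitian `d × d` matrix, counted with multiplicity and listed in
increasing order, `λ₁^↑ ≤ … ≤ λ_d^↑` (here with indices starting at `0`).
Mathlib's `eigenvalues₀` lists them in decreasing order. -/
def eigenvaluesUp {A : Matrix (Fin d) (Fin d) ℂ} (hA : A.IsHermitian) (i : Fin d) : ℝ :=
  hA.eigenvalues₀ (Fin.cast (Fintype.card_fin d).symm i.rev)

/-- The `d` singular values of a `d × d` matrix, counted with multiplicity (zeros included) and
listed in increasing order, `s₁^↑ ≤ … ≤ s_d^↑` (here with indices starting at `0`).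
Mathlib's `singularValues` lists them in decreasing order. -/
def singularValuesUp (T : Matrix (Fin d) (Fin d) ℂ) (i : Fin d) : ℝ :=
  (Matrix.toEuclideanCLM (n := Fin d) (𝕜 := ℂ) T).toLinearMap.singularValues (i.rev : ℕ)

/-- The operator norm of a `d × d` matrix acting on the Euclidean space `ℂ^d`. -/
def opNorm (A : Matrix (Fin d) (Fin d) ℂ) : ℝ :=
  ‖Matrix.toEuclideanCLM (n := Fin d) (𝕜 := ℂ) A‖

/-- The set `I_𝒢` of matrices that, for every `ε > 0`, are a finite product
`e^{G₁} ⋯ e^{G_n}` with all `G_j ∈ 𝒢` and `‖e^{G_j} - 1‖ ≤ ε`. -/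
def InfProducts (𝒢 : Set (Matrix (Fin d) (Fin d) ℂ)) : Set (Matrix (Fin d) (Fin d) ℂ) :=
  {T | ∀ ε : ℝ, 0 < ε → ∃ (n : ℕ) (G : Fin n → Matrix (Fin d) (Fin d) ℂ),
    (∀ j, G j ∈ 𝒢) ∧ (∀ j, opNorm (NormedSpace.exp (G j) - 1) ≤ ε) ∧
      (List.ofFn fun j => NormedSpace.exp (G j)).prod = T}

/-- The infinitesimal Markovian divisible matrices with respect to `𝒢`: the closure of `I_𝒢`. -/
def InfDivisible (𝒢 : Set (Matrix (Fin d) (Fin d) ℂ)) : Set (Matrix (Fin d) (Fin d) ℂ) :=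
  closure (InfProducts 𝒢)

/-- The truncated rays `{t G | t ∈ [0,1], G an extreme point of 𝒢}`. -/
def truncatedRays (𝒢 : Set (Matrix (Fin d) (Fin d) ℂ)) : Set (Matrix (Fin d) (Fin d) ℂ) :=
  {A | ∃ t ∈ Set.Icc (0 : ℝ) 1, ∃ G ∈ Set.extremePoints ℝ 𝒢, A = t • G}

end MarkovDiv

end

namespace MarkovDiv

/-! For a `d × k` matrix `X`, the Gram determinant `det (Xᴴ X)` is the squared volume spanned by its
columns. Along `e^{tG} X` its logarithmic derivative is `Tr ((G + Gᴴ) Q)`, with `Q` the orthogonal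
projection onto the current column space, while `|det e^G|² = exp Tr (G + Gᴴ)`. So the bound for
`e^G` follows once `Tr (G + Gᴴ) ≤ p Tr ((G + Gᴴ) Q)` for every rank-`k` projection `Q`. At extreme
points this is the assumption combined with Ky Fan's principle (`sum_eigenvaluesUp_le_trace`); for
fixed `Q` it is linear in `G`, so Krein–Milman extends it to all of `𝒢`.

The resulting inequality `DetBound`, tested on all `X`, is stable under products and limits, hence
holds on `InfDivisible 𝒢`. Taking for `X` the right singular vectors of the `k` smallest singular
values gives the theorem. In the real case, `tG ∈ 𝒢` for `t ∈ [0,1]` forces `Tr G` to be real, so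
`det e^G > 0`; nonnegativity survives products and limits. -/

/-! ### Jacobi's formula and determinants of exponentials -/

/-- Derivative of the determinant along a matrix curve through the identity. -/
theorem hasDerivAt_det_of_eq_one {n : ℕ} {N : ℝ → Matrix (Fin n) (Fin n) ℂ}
    {N' : Matrix (Fin n) (Fin n) ℂ} {t : ℝ}
    (hN : ∀ i j, HasDerivAt (fun s => N s i j) (N' i j) t) (h1 : N t = 1) :
    HasDerivAt (fun s => (N s).det) N'.trace t := by
  have h : HasDerivAt (fun s => (N s).det)
      (∑ σ : Equiv.Perm (Fin n), ((Equiv.Perm.sign σ : ℤ) : ℂ) *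
        ∑ i, (∏ j ∈ Finset.univ.erase i, N t (σ j) j) • N' (σ i) i) t := by
    simp only [Matrix.det_apply']
    exact HasDerivAt.fun_sum fun σ _ =>
      (HasDerivAt.fun_finsetProd fun i _ => hN (σ i) i).const_mul _
  convert h using 1
  rw [Finset.sum_eq_single (1 : Equiv.Perm (Fin n))]
  · simp [h1, Matrix.trace]
  · intro σ _ hσ
    rw [Finset.sum_eq_zero, mul_zero]
    intro i _
    -- A permutation cannot move exactly one point, so a second moved point contributes an
    -- off-diagonal entry of `1`.
    obtain ⟨j, hj, hji⟩ : ∃ j, σ j ≠ j ∧ j ≠ i := by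
      by_contra! hc
      apply hσ
      ext j
      by_cases hji : σ j = j
      · simp [hji]
      · have hj := hc j hji
        have : σ (σ j) = σ j := by
          by_contra h2
          exact hji (by rw [hc _ h2, hj])
        exact absurd (σ.injective this) hji
    rw [Finset.prod_eq_zero (Finset.mem_erase.2 ⟨hji, Finset.mem_univ j⟩), zero_smul]
    rw [h1, Matrix.one_apply_ne hj]
  · simp

/-- Jacobi's formula at an invertible matrix. -/
theorem hasDerivAt_det {n : ℕ} {N : ℝ → Matrix (Fin n) (Fin n) ℂ}
    {N' : Matrix (Fin n) (Fin n) ℂ} {t : ℝ}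
    (hN : ∀ i j, HasDerivAt (fun s => N s i j) (N' i j) t) (hu : IsUnit (N t).det) :
    HasDerivAt (fun s => (N s).det) ((N t).det * ((N t)⁻¹ * N').trace) t := by
  have h := hasDerivAt_det_of_eq_one (N := fun s => (N t)⁻¹ * N s) (N' := (N t)⁻¹ * N') (t := t)
    (fun i j => by
      simp only [Matrix.mul_apply]
      exact HasDerivAt.fun_sum fun l _ => (hN l j).const_mul _)
    (Matrix.nonsing_inv_mul _ hu)
  have h2 := h.const_mul (N t).det
  have he : (fun s => (N t).det * ((N t)⁻¹ * N s).det) = fun s => (N s).det := by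
    funext s
    rw [← Matrix.det_mul, ← mul_assoc, Matrix.mul_nonsing_inv _ hu, one_mul]
  rwa [he] at h2

open scoped Matrix.Norms.Operator in
theorem hasDerivAt_exp_smul_entry {d : ℕ} (G : Matrix (Fin d) (Fin d) ℂ) (t : ℝ) (i j : Fin d) :
    HasDerivAt (fun s : ℝ => NormedSpace.exp (s • G) i j)
      ((G * NormedSpace.exp (t • G)) i j) t := by
  have h := hasDerivAt_exp_smul_const' (𝕂 := ℝ) G t
  exact ((Matrix.entryLinearMap ℝ ℂ i j).toContinuousLinearMap.hasFDerivAt.comp_hasDerivAt t h)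

theorem isUnit_det_exp {d : ℕ} (G : Matrix (Fin d) (Fin d) ℂ) :
    IsUnit (NormedSpace.exp G).det :=
  (Matrix.isUnit_iff_isUnit_det _).1 (Matrix.isUnit_exp G)

/-- By Jacobi, `det (e^{sG}) e^{-s Tr G}` is constant in `s`; compare `s = 1` with `s = 0`. -/
theorem det_exp_eq_exp_trace {d : ℕ} (G : Matrix (Fin d) (Fin d) ℂ) :
    (NormedSpace.exp G).det = Complex.exp G.trace := by
  have hd : ∀ t : ℝ, HasDerivAt (fun s : ℝ => (NormedSpace.exp (s • G)).det *
      Complex.exp (-(s * G.trace))) 0 t := by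
    intro t
    have h1 := hasDerivAt_det (hasDerivAt_exp_smul_entry G t) (isUnit_det_exp _)
    have h2 : HasDerivAt (fun s : ℝ => Complex.exp (-(s * G.trace)))
        (Complex.exp (-(t * G.trace)) * (-(1 * G.trace))) t :=
      ((Complex.ofRealCLM.hasDerivAt (x := t)).mul_const G.trace).neg.cexp
    refine (h1.fun_mul h2).congr_deriv ?_
    rw [Matrix.trace_mul_comm, mul_assoc G, Matrix.mul_nonsing_inv _ (isUnit_det_exp _)]
    simp
    ring
  have hc := is_const_of_deriv_eq_zero (fun t => (hd t).differentiableAt)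
    (fun t => (hd t).deriv) 1 0
  simp only [one_smul, zero_smul, NormedSpace.exp_zero, Matrix.det_one] at hc
  simp only [Complex.ofReal_one, one_mul, Complex.ofReal_zero, zero_mul, neg_zero,
    Complex.exp_zero, mul_one, Complex.exp_neg] at hc
  exact (mul_inv_eq_one₀ (Complex.exp_ne_zero _)).1 hc

/-! ### Ky Fan's minimum principle -/

/-- Rearrangement estimate: weights in `[0, 1]` of total mass `k` against a monotone sequence. -/
theorem sum_castLE_le_sum_mul {d k : ℕ} (hkd : k ≤ d) {a q : Fin d → ℝ} (ha : Monotone a)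
    (h0 : ∀ i, 0 ≤ q i) (h1 : ∀ i, q i ≤ 1) (hs : ∑ i, q i = k) :
    ∑ i : Fin k, a (Fin.castLE hkd i) ≤ ∑ i, a i * q i := by
  rcases Nat.eq_zero_or_pos k with rfl | hk
  · have hq : ∀ i, q i = 0 := fun i =>
      (Finset.sum_eq_zero_iff_of_nonneg fun i _ => h0 i).1 (by simpa using hs) i (Finset.mem_univ i)
    simp [hq]
  have key : ∀ f : Fin d → ℝ, ∑ i : Fin k, f (Fin.castLE hkd i) =
      ∑ i : Fin d, if (i : ℕ) < k then f i else 0 := by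
    intro f
    rw [← Finset.sum_filter]
    refine Finset.sum_bij (fun i _ => Fin.castLE hkd i) ?_ ?_ ?_ ?_
    · intro i _; simp
    · exact fun i _ j _ h => Fin.castLE_injective hkd h
    · intro j hj
      exact ⟨⟨j, (Finset.mem_filter.1 hj).2⟩, Finset.mem_univ _, rfl⟩
    · intro i _; rfl
  -- With `c` the `k`-th smallest value, `(a i - c) * (q i - 1_{i < k}) ≥ 0` for every `i`; both
  -- weights have mass `k`, so `c` cancels in the sum.
  set c := a ⟨k - 1, by omega⟩
  have hk1 : ∑ i : Fin d, (if (i : ℕ) < k then (1 : ℝ) else 0) = k := by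
    rw [← key]; simp
  have hle : ∀ i : Fin d, (if (i : ℕ) < k then a i else 0) -
      c * (if (i : ℕ) < k then (1 : ℝ) else 0) ≤ a i * q i - c * q i := by
    intro i
    split_ifs with hi
    · have : a i ≤ c := ha (by rw [Fin.le_def]; simp; omega)
      nlinarith [h1 i]
    · have : c ≤ a i := ha (by rw [Fin.le_def]; simp; omega)
      nlinarith [h0 i]
  have := Finset.sum_le_sum fun i (_ : i ∈ Finset.univ) => hle i
  rw [Finset.sum_sub_distrib, Finset.sum_sub_distrib, ← Finset.mul_sum, ← Finset.mul_sum, hk1, hs,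
    ← key] at this
  linarith

theorem re_diag_nonneg_of_isProjection {d : ℕ} {Q : Matrix (Fin d) (Fin d) ℂ}
    (hQ : Q.IsHermitian) (hQQ : Q * Q = Q) (U : Matrix (Fin d) (Fin d) ℂ) (i : Fin d) :
    0 ≤ ((Uᴴ * Q * U) i i).re := by
  have h : Uᴴ * Q * U = (Q * U)ᴴ * (Q * U) := by
    rw [Matrix.conjTranspose_mul, hQ.eq, mul_assoc, mul_assoc, ← mul_assoc Q Q, hQQ]
  rw [h]
  exact (Complex.le_def.1 ((Matrix.posSemidef_conjTranspose_mul_self (Q * U)).diag_nonneg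
    (i := i))).1

/-- The lower bound in Ky Fan's minimum principle. -/
theorem sum_eigenvaluesUp_le_trace {d k : ℕ} (hkd : k ≤ d) {H Q : Matrix (Fin d) (Fin d) ℂ}
    (hH : H.IsHermitian) (hQ : Q.IsHermitian) (hQQ : Q * Q = Q) (htr : Q.trace = k) :
    ∑ i : Fin k, eigenvaluesUp hH (Fin.castLE hkd i) ≤ (H * Q).trace.re := by
  set U : Matrix (Fin d) (Fin d) ℂ := (hH.eigenvectorUnitary : Matrix (Fin d) (Fin d) ℂ)
  have hUU : U * Uᴴ = 1 := Unitary.coe_mul_star_self hH.eigenvectorUnitary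
  have hUU' : Uᴴ * U = 1 := Unitary.coe_star_mul_self hH.eigenvectorUnitary
  set q : Fin d → ℝ := fun i => ((Uᴴ * Q * U) i i).re
  have hq0 : ∀ i, 0 ≤ q i := re_diag_nonneg_of_isProjection hQ hQQ U
  have hq1 : ∀ i, q i ≤ 1 := by
    intro i
    -- The upper bound is positivity for the complementary projection.
    have h := re_diag_nonneg_of_isProjection (Q := 1 - Q) (Matrix.isHermitian_one.sub hQ)
      (by rw [sub_mul, one_mul, mul_sub, mul_one, hQQ, sub_self, sub_zero]) U i
    rw [mul_sub, sub_mul, mul_one, hUU'] at h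
    simpa [q] using h
  have hqs : ∑ i, q i = k := by
    have : (Uᴴ * Q * U).trace = k := by
      rw [Matrix.trace_mul_comm, ← mul_assoc, hUU, one_mul, htr]
    have h2 := congrArg Complex.re this
    simpa [Matrix.trace, q] using h2
  have htrace : (H * Q).trace.re = ∑ i, hH.eigenvalues i * q i := by
    have hs : H = U * Matrix.diagonal (RCLike.ofReal ∘ hH.eigenvalues) * Uᴴ := by
      conv_lhs => rw [hH.spectral_theorem]
      rfl
    conv_lhs => rw [hs]
    rw [mul_assoc, mul_assoc, Matrix.trace_mul_comm, mul_assoc]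
    simp [Matrix.trace, Matrix.diagonal_mul, q]
  set e : Fin d ≃ Fin d := Fin.revPerm.trans ((finCongr (Fintype.card_fin d).symm).trans
    (Fintype.equivOfCardEq (Fintype.card_fin _)))
  have he : ∀ i, hH.eigenvalues (e i) = eigenvaluesUp hH i := by
    intro i
    simp [e, Matrix.IsHermitian.eigenvalues, eigenvaluesUp, Fin.revPerm]
  rw [htrace, ← Equiv.sum_comp e]
  simp only [he]
  refine sum_castLE_le_sum_mul hkd ?_ (fun i => hq0 _) (fun i => hq1 _) ?_
  · intro i j hij
    exact hH.eigenvalues₀_antitone (by simpa [Fin.le_def] using (by omega))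
  · rw [Equiv.sum_comp e q, hqs]

/-! ### Gram determinants and their growth along exponentials -/

/-- The Gram determinant of the columns of `X`. -/
noncomputable def gramDet {d k : ℕ} (X : Matrix (Fin d) (Fin k) ℂ) : ℝ := (Xᴴ * X).det.re

theorem gramDet_eq {d k : ℕ} (X : Matrix (Fin d) (Fin k) ℂ) :
    ((gramDet X : ℝ) : ℂ) = (Xᴴ * X).det := by
  have h := Complex.le_def.1 (Matrix.posSemidef_conjTranspose_mul_self X).det_nonneg
  exact Complex.ext rfl (by simpa using h.2)

theorem gramDet_nonneg {d k : ℕ} (X : Matrix (Fin d) (Fin k) ℂ) : 0 ≤ gramDet X :=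
  (Complex.le_def.1 (Matrix.posSemidef_conjTranspose_mul_self X).det_nonneg).1

theorem continuous_gramDet {d k : ℕ} : Continuous (gramDet (d := d) (k := k)) := by
  unfold gramDet
  fun_prop

/-- Multiplication by an invertible matrix does not make the Gram determinant vanish. -/
theorem gramDet_mul_ne_zero {d k : ℕ} {X : Matrix (Fin d) (Fin k) ℂ} (hX : gramDet X ≠ 0)
    {E : Matrix (Fin d) (Fin d) ℂ} (hE : IsUnit E.det) : gramDet (E * X) ≠ 0 := by
  have hX' : IsUnit (Xᴴ * X).det := by
    rw [← gramDet_eq, isUnit_iff_ne_zero]; exact_mod_cast hX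
  -- `(Xᴴ X)⁻¹ Xᴴ E⁻¹` is an explicit left inverse of `E X`.
  have hinj : Function.Injective (E * X).mulVec := by
    intro v w hvw
    have h := congrArg (fun u => ((Xᴴ * X)⁻¹ * (Xᴴ * E⁻¹)) *ᵥ u) hvw
    simp only [Matrix.mulVec_mulVec] at h
    have h2 : (Xᴴ * X)⁻¹ * (Xᴴ * E⁻¹) * (E * X) = 1 := by
      rw [Matrix.mul_assoc, Matrix.mul_assoc, ← Matrix.mul_assoc E⁻¹,
        Matrix.nonsing_inv_mul _ hE, Matrix.one_mul,
        Matrix.nonsing_inv_mul _ hX']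
    rwa [h2, Matrix.one_mulVec, Matrix.one_mulVec] at h
  have hp := (Matrix.PosDef.conjTranspose_mul_self (E * X) hinj).det_pos
  rw [← gramDet_eq] at hp
  exact_mod_cast hp.ne'

/-- The orthogonal projection onto the column space of `Y`, when the columns are independent. -/
noncomputable def colProj {d k : ℕ} (Y : Matrix (Fin d) (Fin k) ℂ) : Matrix (Fin d) (Fin d) ℂ :=
  Y * (Yᴴ * Y)⁻¹ * Yᴴ

theorem isHermitian_colProj {d k : ℕ} (Y : Matrix (Fin d) (Fin k) ℂ) :
    (colProj Y).IsHermitian := by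
  unfold colProj Matrix.IsHermitian
  rw [Matrix.conjTranspose_mul, Matrix.conjTranspose_mul, Matrix.conjTranspose_conjTranspose,
    Matrix.conjTranspose_nonsing_inv, (Matrix.isHermitian_conjTranspose_mul_self Y).eq,
    Matrix.mul_assoc]

theorem colProj_mul_self {d k : ℕ} {Y : Matrix (Fin d) (Fin k) ℂ} (hY : IsUnit (Yᴴ * Y).det) :
    colProj Y * colProj Y = colProj Y := by
  unfold colProj
  calc Y * (Yᴴ * Y)⁻¹ * Yᴴ * (Y * (Yᴴ * Y)⁻¹ * Yᴴ)
      = Y * ((Yᴴ * Y)⁻¹ * (Yᴴ * Y)) * (Yᴴ * Y)⁻¹ * Yᴴ := by simp only [Matrix.mul_assoc]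
    _ = Y * (Yᴴ * Y)⁻¹ * Yᴴ := by rw [Matrix.nonsing_inv_mul _ hY, Matrix.mul_one]

theorem trace_colProj {d k : ℕ} {Y : Matrix (Fin d) (Fin k) ℂ} (hY : IsUnit (Yᴴ * Y).det) :
    (colProj Y).trace = k := by
  unfold colProj
  rw [Matrix.trace_mul_comm, ← Matrix.mul_assoc, Matrix.mul_nonsing_inv _ hY, Matrix.trace_one,
    Fintype.card_fin]

/-- With `Y = e^{tG} X`, the derivative of `Yᴴ Y` is `Yᴴ (G + Gᴴ) Y`; Jacobi's formula and cyclicity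
of the trace then produce the column projection. -/
theorem hasDerivAt_gramDet_exp {d k : ℕ} (G : Matrix (Fin d) (Fin d) ℂ)
    {X : Matrix (Fin d) (Fin k) ℂ} (hX : gramDet X ≠ 0) (t : ℝ) :
    HasDerivAt (fun s : ℝ => gramDet (NormedSpace.exp (s • G) * X))
      (gramDet (NormedSpace.exp (t • G) * X) *
        ((G + Gᴴ) * colProj (NormedSpace.exp (t • G) * X)).trace.re) t := by
  set Y : ℝ → Matrix (Fin d) (Fin k) ℂ := fun s => NormedSpace.exp (s • G) * X with hYdef
  have hY : ∀ i j, HasDerivAt (fun s => Y s i j) ((G * Y t) i j) t := by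
    intro i j
    have h := HasDerivAt.fun_sum (u := Finset.univ) fun l (_ : l ∈ Finset.univ) =>
      (hasDerivAt_exp_smul_entry G t i l).mul_const (X l j)
    refine h.congr_deriv ?_
    rw [hYdef]
    simp only
    rw [← Matrix.mul_assoc, Matrix.mul_apply]
  have hM : ∀ i j, HasDerivAt (fun s => ((Y s)ᴴ * Y s) i j)
      (((Y t)ᴴ * (G + Gᴴ) * Y t) i j) t := by
    intro i j
    have h := HasDerivAt.fun_sum (u := Finset.univ) fun l (_ : l ∈ Finset.univ) =>
      ((hY l i).star).fun_mul (hY l j)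
    refine h.congr_deriv ?_
    have h3 : (Y t)ᴴ * (G + Gᴴ) * Y t = (G * Y t)ᴴ * Y t + (Y t)ᴴ * (G * Y t) := by
      rw [Matrix.conjTranspose_mul G, Matrix.mul_add, Matrix.add_mul, add_comm, Matrix.mul_assoc _ G]
    rw [h3, Matrix.add_apply, Matrix.mul_apply, Matrix.mul_apply, ← Finset.sum_add_distrib]
    rfl
  have hu : IsUnit ((Y t)ᴴ * Y t).det := by
    rw [← gramDet_eq, isUnit_iff_ne_zero]
    exact_mod_cast gramDet_mul_ne_zero hX (isUnit_det_exp _)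
  have h := hasDerivAt_det hM hu
  have h2 := Complex.reCLM.hasFDerivAt.comp_hasDerivAt t h
  refine h2.congr_deriv ?_
  have h4 : (((Y t)ᴴ * Y t)⁻¹ * ((Y t)ᴴ * (G + Gᴴ) * Y t)).trace =
      ((G + Gᴴ) * colProj (Y t)).trace := by
    unfold colProj
    rw [Matrix.trace_mul_comm, Matrix.mul_assoc, Matrix.mul_assoc, Matrix.trace_mul_comm,
      Matrix.mul_assoc, Matrix.mul_assoc, Matrix.mul_assoc]
  rw [h4, ← gramDet_eq, Complex.reCLM_apply, Complex.re_ofReal_mul]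

/-- Grönwall-type lower bound for the Gram determinant along `e^{tG}`. -/
theorem exp_mul_gramDet_le {d k : ℕ} {G : Matrix (Fin d) (Fin d) ℂ} {c : ℝ}
    (hc : ∀ Q : Matrix (Fin d) (Fin d) ℂ, Q.IsHermitian → Q * Q = Q → Q.trace = k →
      c ≤ ((G + Gᴴ) * Q).trace.re) (X : Matrix (Fin d) (Fin k) ℂ) :
    Real.exp c * gramDet X ≤ gramDet (NormedSpace.exp G * X) := by
  by_cases hX : gramDet X = 0
  · rw [hX, mul_zero]; exact gramDet_nonneg _
  have hd : ∀ t : ℝ, HasDerivAt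
      (fun s : ℝ => gramDet (NormedSpace.exp (s • G) * X) * Real.exp (-(s * c)))
      (gramDet (NormedSpace.exp (t • G) * X) *
        ((G + Gᴴ) * colProj (NormedSpace.exp (t • G) * X)).trace.re * Real.exp (-(t * c)) +
        gramDet (NormedSpace.exp (t • G) * X) * (Real.exp (-(t * c)) * (-(1 * c)))) t := fun t =>
    (hasDerivAt_gramDet_exp G hX t).fun_mul (((hasDerivAt_id t).mul_const c).fun_neg.exp)
  -- Multiplying by the integrating factor `e^{-sc}` leaves a derivative with the sign of `Tr ((G +
  -- Gᴴ) Q) - c`, where `Q` is the column projection.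
  have hmono : Monotone
      (fun s : ℝ => gramDet (NormedSpace.exp (s • G) * X) * Real.exp (-(s * c))) := by
    refine monotone_of_deriv_nonneg (fun t => (hd t).differentiableAt) fun t => ?_
    rw [(hd t).deriv]
    have hu : IsUnit ((NormedSpace.exp (t • G) * X)ᴴ * (NormedSpace.exp (t • G) * X)).det := by
      rw [← gramDet_eq, isUnit_iff_ne_zero]
      exact_mod_cast gramDet_mul_ne_zero hX (isUnit_det_exp _)
    have h1 := hc _ (isHermitian_colProj _) (colProj_mul_self hu) (trace_colProj hu)
    have h2 := mul_nonneg (mul_nonneg (gramDet_nonneg (NormedSpace.exp (t • G) * X))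
      (Real.exp_pos (-(t * c))).le) (sub_nonneg.2 h1)
    linarith
  have h := hmono (zero_le_one (α := ℝ))
  simp only [zero_smul, NormedSpace.exp_zero, Matrix.one_mul, zero_mul, neg_zero, Real.exp_zero,
    mul_one, one_smul, one_mul, Real.exp_neg] at h
  rwa [← div_eq_mul_inv, le_div_iff₀ (Real.exp_pos c), mul_comm] at h

/-! ### The multiplicative, closed determinant bound -/

/-- The determinant bound tested on all `k`-tuples of vectors. It is multiplicative and closed. -/
def DetBound {d : ℕ} (k : ℕ) (p : ℝ) (T : Matrix (Fin d) (Fin d) ℂ) : Prop :=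
  ∀ X : Matrix (Fin d) (Fin k) ℂ, ‖T.det‖ ^ 2 * gramDet X ^ p ≤ gramDet (T * X) ^ p

theorem DetBound.one {d k : ℕ} {p : ℝ} : DetBound k p (1 : Matrix (Fin d) (Fin d) ℂ) := by
  intro X; simp

theorem DetBound.mul {d k : ℕ} {p : ℝ} {S T : Matrix (Fin d) (Fin d) ℂ}
    (hS : DetBound k p S) (hT : DetBound k p T) : DetBound k p (S * T) := by
  intro X
  rw [Matrix.det_mul, norm_mul, mul_pow, mul_assoc, Matrix.mul_assoc]
  exact (mul_le_mul_of_nonneg_left (hT X) (by positivity)).trans (hS (T * X))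

theorem DetBound.list_prod {d k : ℕ} {p : ℝ} {L : List (Matrix (Fin d) (Fin d) ℂ)}
    (h : ∀ T ∈ L, DetBound k p T) : DetBound k p L.prod := by
  induction L with
  | nil => exact DetBound.one
  | cons T L ih =>
    rw [List.prod_cons]
    exact (h T (by simp)).mul (ih fun S hS => h S (by simp [hS]))

theorem isClosed_detBound {d k : ℕ} {p : ℝ} (hp : 0 < p) :
    IsClosed {T : Matrix (Fin d) (Fin d) ℂ | DetBound k p T} := by
  simp only [DetBound, Set.ofPred_forall]
  refine isClosed_iInter fun X => isClosed_le ?_ ?_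
  · exact ((continuous_id.matrix_det.norm).pow 2).mul continuous_const
  · exact (continuous_gramDet.comp (continuous_id.matrix_mul continuous_const)).rpow_const
      fun _ => Or.inr hp.le

theorem trace_add_conjTranspose_re {d : ℕ} (G : Matrix (Fin d) (Fin d) ℂ) :
    (G + Gᴴ).trace.re = 2 * G.trace.re := by
  rw [Matrix.trace_add, Matrix.trace_conjTranspose]
  simp [two_mul]

theorem norm_det_exp_sq {d : ℕ} (G : Matrix (Fin d) (Fin d) ℂ) :
    ‖(NormedSpace.exp G).det‖ ^ 2 = Real.exp (G + Gᴴ).trace.re := by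
  rw [det_exp_eq_exp_trace, Complex.norm_exp, trace_add_conjTranspose_re, ← Real.exp_nat_mul]
  norm_num

theorem DetBound.exp {d k : ℕ} {p : ℝ} (hp : 0 < p) {G : Matrix (Fin d) (Fin d) ℂ}
    (hG : ∀ Q : Matrix (Fin d) (Fin d) ℂ, Q.IsHermitian → Q * Q = Q → Q.trace = k →
      (G + Gᴴ).trace.re ≤ p * ((G + Gᴴ) * Q).trace.re) :
    DetBound k p (NormedSpace.exp G) := by
  intro X
  -- Dividing by `p` makes `e^c` raised to the power `p` equal `|det e^G|²`.
  have h := exp_mul_gramDet_le (c := (G + Gᴴ).trace.re / p) (fun Q h1 h2 h3 => by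
    rw [div_le_iff₀' hp]; exact hG Q h1 h2 h3) X
  have h2 := Real.rpow_le_rpow (mul_nonneg (Real.exp_pos _).le (gramDet_nonneg X)) h hp.le
  rwa [Real.mul_rpow (Real.exp_pos _).le (gramDet_nonneg X), ← Real.exp_mul,
    div_mul_cancel₀ _ hp.ne', ← norm_det_exp_sq] at h2

/-- Krein–Milman: a real-linear inequality on a compact convex set holds if it holds at the extreme
points. -/
theorem nonpos_of_extremePoints {d : ℕ} {𝒢 : Set (Matrix (Fin d) (Fin d) ℂ)}
    (hcompact : IsCompact 𝒢) (hconvex : Convex ℝ 𝒢) (f : Matrix (Fin d) (Fin d) ℂ →ₗ[ℝ] ℝ)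
    (hf : ∀ G ∈ Set.extremePoints ℝ 𝒢, f G ≤ 0) : ∀ G ∈ 𝒢, f G ≤ 0 := by
  have : LocallyConvexSpace ℝ (Matrix (Fin d) (Fin d) ℂ) :=
    inferInstanceAs (LocallyConvexSpace ℝ (Fin d → Fin d → ℂ))
  have h : closure (convexHull ℝ (Set.extremePoints ℝ 𝒢)) ⊆ {G | f G ≤ 0} := by
    refine closure_minimal (convexHull_min hf (convex_halfSpace_le f.isLinear 0)) ?_
    exact isClosed_le f.continuous_of_finiteDimensional continuous_const
  rw [closure_convexHull_extremePoints hcompact hconvex] at h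
  exact h

/-! ### Singular values -/

/-- The `k` right singular vectors with smallest singular values are an orthonormal tuple whose
image has Gram determinant the product of the squared singular values. -/
theorem exists_gramDet_eq_prod_singularValuesUp {d k : ℕ} (hkd : k ≤ d)
    (T : Matrix (Fin d) (Fin d) ℂ) : ∃ X : Matrix (Fin d) (Fin k) ℂ, gramDet X = 1 ∧
      gramDet (T * X) = (∏ i : Fin k, singularValuesUp T (Fin.castLE hkd i)) ^ 2 := by
  set S := (Matrix.toEuclideanCLM (n := Fin d) (𝕜 := ℂ) T).toLinearMap with hS
  have hn : Module.finrank ℂ (EuclideanSpace ℂ (Fin d)) = d := finrank_euclideanSpace_fin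
  set b := S.isSymmetric_adjoint_comp_self.eigenvectorBasis hn
  -- The basis follows the singular values in decreasing order, so `rev` selects the smallest ones.
  set v : Fin k → EuclideanSpace ℂ (Fin d) := fun i => b (Fin.castLE hkd i).rev
  have hv : ∀ i j, inner ℂ (v i) (v j) = if i = j then (1 : ℂ) else 0 := by
    intro i j
    rw [b.inner_eq_ite]
    simp [Fin.rev_inj]
  refine ⟨Matrix.of fun j i => v i j, ?_, ?_⟩
  · have h : (Matrix.of fun j i => v i j)ᴴ * (Matrix.of fun j i => v i j) =
        (1 : Matrix (Fin k) (Fin k) ℂ) := by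
      ext i j
      rw [Matrix.one_apply, ← hv i j, PiLp.inner_apply, Matrix.mul_apply]
      simp [mul_comm]
    rw [gramDet, h, Matrix.det_one, Complex.one_re]
  · have hcol : ∀ i j, (T * Matrix.of fun j i => v i j) i j = S (v j) i := by
      intro i j
      rfl
    have h : (T * Matrix.of fun j i => v i j)ᴴ * (T * Matrix.of fun j i => v i j) =
        Matrix.diagonal fun i : Fin k =>
          (((singularValuesUp T (Fin.castLE hkd i)) ^ 2 : ℝ) : ℂ) := by
      ext i j
      have h1 : ((T * Matrix.of fun j i => v i j)ᴴ * (T * Matrix.of fun j i => v i j)) i j =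
          inner ℂ (S (v i)) (S (v j)) := by
        rw [PiLp.inner_apply, Matrix.mul_apply]
        simp only [Matrix.conjTranspose_apply, hcol]
        exact Finset.sum_congr rfl fun l _ => mul_comm _ _
      have h2 : S.adjoint (S (v j)) =
          (((singularValuesUp T (Fin.castLE hkd j)) ^ 2 : ℝ) : ℂ) • v j := by
        rw [singularValuesUp, S.sq_singularValues_fin hn]
        exact S.isSymmetric_adjoint_comp_self.apply_eigenvectorBasis hn _
      rw [h1, ← LinearMap.adjoint_inner_right, h2, inner_smul_right, hv, Matrix.diagonal_apply]
      split_ifs with hij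
      · rw [hij, mul_one]
      · rw [mul_zero]
    rw [gramDet, h, Matrix.det_diagonal, ← Complex.ofReal_prod, Complex.ofReal_re,
      Finset.prod_pow]

theorem singularValuesUp_nonneg {d : ℕ} (T : Matrix (Fin d) (Fin d) ℂ) (i : Fin d) :
    0 ≤ singularValuesUp T i :=
  LinearMap.singularValues_nonneg _ _

theorem DetBound.norm_det_le {d k : ℕ} {p : ℝ} (hkd : k ≤ d) {T : Matrix (Fin d) (Fin d) ℂ}
    (h : DetBound k p T) :
    ‖T.det‖ ≤ (∏ i : Fin k, singularValuesUp T (Fin.castLE hkd i)) ^ p := by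
  obtain ⟨X, hX1, hX2⟩ := exists_gramDet_eq_prod_singularValuesUp hkd T
  have h0 : 0 ≤ ∏ i : Fin k, singularValuesUp T (Fin.castLE hkd i) :=
    Finset.prod_nonneg fun i _ => singularValuesUp_nonneg _ _
  have hX := h X
  rw [hX1, hX2, Real.one_rpow, mul_one, ← Real.rpow_natCast_mul h0, mul_comm,
    Real.rpow_mul_natCast h0] at hX
  exact le_of_sq_le_sq hX (Real.rpow_nonneg h0 p)

/-! ### Sign of the determinant and passage to the closure -/

/-- If the imaginary part of the trace is an integer multiple of `π` along a segment from `0`, it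
vanishes. -/
theorem trace_im_eq_zero {d : ℕ} {G : Matrix (Fin d) (Fin d) ℂ}
    (h : ∀ t ∈ Set.Icc (0 : ℝ) 1, (NormedSpace.exp (t • G)).det.im = 0) : G.trace.im = 0 := by
  by_contra hne
  set y := G.trace.im
  have hpos : 0 < |y| := abs_pos.2 hne
  -- This `t` gives `|t y| < 1 < π`, where the sine vanishes only at `0`.
  have ht : (1 + |y|)⁻¹ ∈ Set.Icc (0 : ℝ) 1 :=
    ⟨by positivity, inv_le_one_of_one_le₀ (by linarith)⟩
  have h1 := h _ ht
  rw [det_exp_eq_exp_trace, Matrix.trace_smul, Complex.exp_im] at h1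
  have h2 : ((1 + |y|)⁻¹ • G.trace).im = (1 + |y|)⁻¹ * y := Complex.smul_im _ _
  rw [h2] at h1
  have h3 := (mul_eq_zero.1 h1).resolve_left (Real.exp_pos _).ne'
  have habs : |(1 + |y|)⁻¹ * y| < 1 := by
    rw [abs_mul, abs_of_pos (by positivity : 0 < (1 + |y|)⁻¹), inv_mul_lt_iff₀ (by positivity)]
    linarith
  have hpi := Real.pi_gt_three
  have h4 := (Real.sin_eq_zero_iff_of_lt_of_lt (by linarith [(abs_lt.1 habs).1])
    (by linarith [(abs_lt.1 habs).2])).1 h3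
  rcases mul_eq_zero.1 h4 with h5 | h5
  · exact absurd h5 (by positivity)
  · exact hne h5

theorem det_exp_nonneg {d : ℕ} {G : Matrix (Fin d) (Fin d) ℂ} (h : G.trace.im = 0) :
    0 ≤ (NormedSpace.exp G).det := by
  have : G.trace = ((G.trace.re : ℝ) : ℂ) := Complex.ext rfl (by simpa using h)
  rw [det_exp_eq_exp_trace, this, ← Complex.ofReal_exp]
  exact_mod_cast (Real.exp_pos _).le

/-- A closed multiplicative property of all `e^G`, `G ∈ 𝒢`, passes to `InfDivisible 𝒢`. -/
theorem InfDivisible.induction {d : ℕ} {𝒢 P : Set (Matrix (Fin d) (Fin d) ℂ)}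
    (hP : IsClosed P) (hlist : ∀ L : List (Matrix (Fin d) (Fin d) ℂ), (∀ S ∈ L, S ∈ P) → L.prod ∈ P)
    (hexp : ∀ G ∈ 𝒢, NormedSpace.exp G ∈ P) {T : Matrix (Fin d) (Fin d) ℂ}
    (hT : T ∈ InfDivisible 𝒢) : T ∈ P := by
  refine closure_minimal ?_ hP hT
  intro S hS
  obtain ⟨n, G, hG, -, rfl⟩ := hS 1 one_pos
  refine hlist _ fun S hS => ?_
  obtain ⟨j, rfl⟩ := (List.mem_ofFn' _ _).1 hS
  exact hexp _ (hG j)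

theorem det_nonneg_of_infDivisible {d : ℕ} {𝒢 : Set (Matrix (Fin d) (Fin d) ℂ)}
    (hexp : ∀ G ∈ 𝒢, 0 ≤ (NormedSpace.exp G).det) {T : Matrix (Fin d) (Fin d) ℂ}
    (hT : T ∈ InfDivisible 𝒢) : 0 ≤ T.det := by
  refine InfDivisible.induction (P := {S | 0 ≤ S.det})
    (isClosed_le continuous_const continuous_id.matrix_det) ?_ hexp hT
  intro L hL
  induction L with
  | nil => simp
  | cons S L ih =>
    rw [List.prod_cons, Set.mem_ofPred_eq, Matrix.det_mul]
    exact mul_nonneg (hL S (by simp)) (ih fun R hR => hL R (by simp [hR]))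

/-- `G ↦ Tr (G + G*) - p Tr ((G + G*) Q)` as a real-linear functional. -/
noncomputable def traceFunctional {d : ℕ} (p : ℝ) (Q : Matrix (Fin d) (Fin d) ℂ) :
    Matrix (Fin d) (Fin d) ℂ →ₗ[ℝ] ℝ where
  toFun G := (G + Gᴴ).trace.re - p * ((G + Gᴴ) * Q).trace.re
  map_add' G H := by
    simp only [Matrix.conjTranspose_add, Matrix.trace_add, Matrix.add_mul, Complex.add_re]
    ring
  map_smul' r G := by
    simp only [Matrix.conjTranspose_smul, star_trivial, ← smul_add, Matrix.smul_mul,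
      Matrix.trace_smul, Complex.smul_re, smul_eq_mul, RingHom.id_apply]
    ring

end MarkovDiv

theorem corollary4p5 {d k : ℕ} (hk1 : 1 ≤ k) (hkd : k ≤ d) {p : ℝ} (hp : 0 < p)
    (𝒢 : Set (Matrix (Fin d) (Fin d) ℂ))
    (hcompact : IsCompact 𝒢) (hconvex : Convex ℝ 𝒢) (hzero : (0 : Matrix (Fin d) (Fin d) ℂ) ∈ 𝒢)
    (hineq : ∀ A ∈ MarkovDiv.truncatedRays 𝒢,
      (A + Aᴴ).trace.re - p * ∑ i : Fin k,
        MarkovDiv.eigenvaluesUp (Matrix.isHermitian_add_transpose_self A) (Fin.castLE hkd i) ≤ 0)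
    (T : Matrix (Fin d) (Fin d) ℂ) (hT : T ∈ MarkovDiv.InfDivisible 𝒢) :
    ‖T.det‖ ≤ (∏ i : Fin k, MarkovDiv.singularValuesUp T (Fin.castLE hkd i)) ^ p ∧
    ((∀ G ∈ 𝒢, (NormedSpace.exp G).det.im = 0) →
      0 ≤ T.det ∧
      T.det ≤ (((∏ i : Fin k, MarkovDiv.singularValuesUp T (Fin.castLE hkd i)) ^ p : ℝ) : ℂ)) := by
  have hexp : ∀ G ∈ 𝒢, MarkovDiv.DetBound k p (NormedSpace.exp G) := by
    refine fun G hG => MarkovDiv.DetBound.exp hp fun Q hQ hQQ htr => sub_nonpos.1 ?_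
    refine MarkovDiv.nonpos_of_extremePoints hcompact hconvex (MarkovDiv.traceFunctional p Q)
      (fun A hA => ?_) G hG
    -- The extreme point itself is the endpoint `t = 1` of its ray.
    have h1 := hineq A ⟨1, by simp, A, hA, (one_smul ℝ A).symm⟩
    have h2 := MarkovDiv.sum_eigenvaluesUp_le_trace hkd
      (Matrix.isHermitian_add_transpose_self A) hQ hQQ htr
    exact (sub_le_sub_left (mul_le_mul_of_nonneg_left h2 hp.le) _).trans h1
  have hbound := (MarkovDiv.InfDivisible.induction (MarkovDiv.isClosed_detBound hp)
    (fun L hL => MarkovDiv.DetBound.list_prod hL) hexp hT).norm_det_le hkd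
  refine ⟨hbound, fun hreal => ?_⟩
  have h0 : 0 ≤ T.det := MarkovDiv.det_nonneg_of_infDivisible (fun G hG =>
    MarkovDiv.det_exp_nonneg (MarkovDiv.trace_im_eq_zero fun t ht =>
      hreal _ (hconvex.smul_mem_of_zero_mem hzero hG ht))) hT
  refine ⟨h0, ?_⟩
  rw [← Complex.norm_of_nonneg' h0]
  exact_mod_cast hbound
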